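/- Let $K$ be a field and let $R$ be an associative unital $K$-algebra, not necessarily commutative. Let $\mathcal{F}$ be an exhaustive finite-dimensional filtration of $R$, that is, a chain $\mathcal{F}_0\subseteq\mathcal{F}_1\subseteq\mathcal{F}_2\subseteq\cdots$ of finite-dimensional $K$-subspaces of $R$ such that $1\in\mathcal{F}_0$, $\mathcal{F}_i\mathcal{F}_j\subseteq\mathcal{F}_{i+j}$ for all $i,j\ge 0$, and $R=\bigcup_{i\ge 0}\mathcal{F}_i$. If the associated graded algebra $$\operatorname{gr}_{\mathcal{F}}(R)=\bigoplus_{n\ge 0}\mathcal{F}_n/\mathcal{F}_{n-1}\qquad(\mathcal{F}_{-1}=0),$$ with the multiplication induced from $R$, is Noetherian (left and right), then $R$ is finitely presented: there are an integer $n\ge 0$ and a surjective $K$-algebra homomorphism $K\langle x_1,\dots,x_n\rangle\to R$ from a free associative algebra whose kernel is generated, as a two-sided ideal, by finitely many elements. -/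

import Mathlib

universe u v

/-- An increasing filtration `F 0 ⊆ F 1 ⊆ ⋯` of a `K`-algebra `R` by `K`-subspaces, with
`K · 1 ⊆ F 0` and `F i * F j ⊆ F (i + j)`. -/
structure AlgFiltration (K : Type u) (R : Type v) [Field K] [Ring R] [Algebra K R] where
  /-- The `n`-th subspace of the filtration. -/
  filt : ℕ → Submodule K R
  mono : Monotone filt
  one_mem : (1 : R) ∈ filt 0
  mul_mem : ∀ {i j : ℕ} {a b : R}, a ∈ filt i → b ∈ filt j → a * b ∈ filt (i + j)

namespace AlgFiltration

variable {K : Type u} {R : Type v} [Field K] [Ring R] [Algebra K R] (F : AlgFiltration K R)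

/-- All subspaces of the filtration are finite-dimensional. -/
def IsFiniteDimensional : Prop := ∀ n, FiniteDimensional K (F.filt n)

/-- The filtration is exhaustive: `R` is the union of its subspaces. -/
def IsExhaustive : Prop := ∀ r : R, ∃ n, r ∈ F.filt n

/-- The preceding subspace of the filtration, `F (n - 1)`, where `F (-1) = 0`. -/
def prev : ℕ → Submodule K R
  | 0 => ⊥
  | n + 1 => F.filt n

/-- The `n`-th component `F n / F (n - 1)` of the associated graded algebra. -/
def Piece (n : ℕ) : Type v := F.filt n ⧸ (F.prev n).submoduleOf (F.filt n)

instance (n : ℕ) : AddCommGroup (F.Piece n) :=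
  inferInstanceAs (AddCommGroup (F.filt n ⧸ (F.prev n).submoduleOf (F.filt n)))

instance (n : ℕ) : Module K (F.Piece n) :=
  inferInstanceAs (Module K (F.filt n ⧸ (F.prev n).submoduleOf (F.filt n)))

/-- The quotient map `F n → F n / F (n - 1)`. -/
def symbol (n : ℕ) : F.filt n →ₗ[K] F.Piece n :=
  ((F.prev n).submoduleOf (F.filt n)).mkQ

theorem symbol_surjective (n : ℕ) : Function.Surjective (F.symbol n) :=
  Submodule.mkQ_surjective _

theorem symbol_eq_zero_iff {n : ℕ} (x : F.filt n) : F.symbol n x = 0 ↔ (x : R) ∈ F.prev n :=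
  Submodule.Quotient.mk_eq_zero _

theorem mul_mem_prev_left {i j : ℕ} {a b : R} (ha : a ∈ F.prev i) (hb : b ∈ F.filt j) :
    a * b ∈ F.prev (i + j) := by
  cases i with
  | zero =>
    have h : a = 0 := ha
    simp [h]
  | succ i =>
    rw [Nat.succ_add]
    exact F.mul_mem (show a ∈ F.filt i from ha) hb

theorem mul_mem_prev_right {i j : ℕ} {a b : R} (ha : a ∈ F.filt i) (hb : b ∈ F.prev j) :
    a * b ∈ F.prev (i + j) := by
  cases j with
  | zero =>
    have h : b = 0 := hb
    simp [h]
  | succ j => exact F.mul_mem ha (show b ∈ F.filt j from hb)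

/-- Multiplication `F i × F j → F (i + j)` induced by that of `R`. -/
def filtMul (i j : ℕ) : F.filt i →ₗ[K] F.filt j →ₗ[K] F.filt (i + j) :=
  LinearMap.mk₂ K (fun a b => ⟨(a : R) * (b : R), F.mul_mem a.2 b.2⟩)
    (fun _ _ _ => Subtype.ext (add_mul _ _ _))
    (fun _ _ _ => Subtype.ext (smul_mul_assoc _ _ _))
    (fun _ _ _ => Subtype.ext (mul_add _ _ _))
    (fun _ _ _ => Subtype.ext (mul_smul_comm _ _ _))

/-- Multiplication `F i / F (i - 1) × F j / F (j - 1) → F (i + j) / F (i + j - 1)` of the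
associated graded algebra, sending the classes of `a` and `b` to the class of `a * b`. -/
def pieceMul (i j : ℕ) : F.Piece i →ₗ[K] F.Piece j →ₗ[K] F.Piece (i + j) :=
  Submodule.liftQ _
    (LinearMap.flip <| Submodule.liftQ _
      (((F.filtMul i j).compr₂ (F.symbol (i + j))).flip)
      (fun b hb => LinearMap.ext fun a =>
        (F.symbol_eq_zero_iff _).2 (F.mul_mem_prev_right a.2 hb)))
    (fun a ha => LinearMap.ext fun b => by
      obtain ⟨b, rfl⟩ := F.symbol_surjective j b
      exact (F.symbol_eq_zero_iff _).2 (F.mul_mem_prev_left ha b.2))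

theorem pieceMul_symbol {i j : ℕ} (a : F.filt i) (b : F.filt j) :
    F.pieceMul i j (F.symbol i a) (F.symbol j b) =
      F.symbol (i + j) ⟨(a : R) * (b : R), F.mul_mem a.2 b.2⟩ := rfl

theorem mk_symbol_eq {i j : ℕ} (h : i = j) {a : F.filt i} {b : F.filt j} (hab : (a : R) = b) :
    GradedMonoid.mk (A := F.Piece) i (F.symbol i a) = GradedMonoid.mk j (F.symbol j b) := by
  subst h
  rw [Subtype.ext hab]

instance : GradedMonoid.GMul F.Piece where
  mul a b := F.pieceMul _ _ a b

instance : GradedMonoid.GOne F.Piece where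
  one := F.symbol 0 ⟨1, F.one_mem⟩

instance : DirectSum.GRing F.Piece where
  mul_zero _ := map_zero _
  zero_mul _ := by
    change F.pieceMul _ _ 0 _ = 0
    rw [map_zero, LinearMap.zero_apply]
  mul_add _ _ _ := map_add _ _ _
  add_mul _ _ _ := by
    change F.pieceMul _ _ (_ + _) _ = F.pieceMul _ _ _ _ + F.pieceMul _ _ _ _
    rw [map_add, LinearMap.add_apply]
  one_mul := by
    rintro ⟨i, a⟩
    obtain ⟨a, rfl⟩ := F.symbol_surjective i a
    exact F.mk_symbol_eq (zero_add i) (one_mul (a : R))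
  mul_one := by
    rintro ⟨i, a⟩
    obtain ⟨a, rfl⟩ := F.symbol_surjective i a
    exact F.mk_symbol_eq (add_zero i) (mul_one (a : R))
  mul_assoc := by
    rintro ⟨i, a⟩ ⟨j, b⟩ ⟨k, c⟩
    obtain ⟨a, rfl⟩ := F.symbol_surjective i a
    obtain ⟨b, rfl⟩ := F.symbol_surjective j b
    obtain ⟨c, rfl⟩ := F.symbol_surjective k c
    exact F.mk_symbol_eq (add_assoc i j k) (mul_assoc (a : R) b c)
  natCast n := n • F.symbol 0 ⟨1, F.one_mem⟩
  natCast_zero := zero_smul _ _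
  natCast_succ n := succ_nsmul _ n
  intCast n := n • F.symbol 0 ⟨1, F.one_mem⟩
  intCast_ofNat n := natCast_zsmul _ n
  intCast_negSucc_ofNat n := negSucc_zsmul _ n

theorem smul_one_mem (c : K) : c • (1 : R) ∈ F.filt 0 := Submodule.smul_mem _ c F.one_mem

instance : DirectSum.GAlgebra K F.Piece where
  toFun := ((LinearMap.id (R := K) (M := K)).smulRight
    (F.symbol 0 ⟨1, F.one_mem⟩)).toAddMonoidHom
  map_one := one_smul K (F.symbol 0 ⟨1, F.one_mem⟩)
  map_mul c d := F.mk_symbol_eq (a := (c * d) • ⟨1, F.one_mem⟩)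
    (b := ⟨(c • (1 : R)) * (d • (1 : R)), F.mul_mem (F.smul_one_mem c) (F.smul_one_mem d)⟩)
    (zero_add 0).symm (by simp [smul_smul, mul_comm])
  commutes := by
    rintro c ⟨i, a⟩
    obtain ⟨a, rfl⟩ := F.symbol_surjective i a
    exact F.mk_symbol_eq (a := ⟨(c • (1 : R)) * a, F.mul_mem (F.smul_one_mem c) a.2⟩)
      (b := ⟨a * (c • (1 : R)), F.mul_mem a.2 (F.smul_one_mem c)⟩) (add_comm 0 i) (by simp)
  smul_def := by
    rintro c ⟨i, a⟩
    obtain ⟨a, rfl⟩ := F.symbol_surjective i a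
    exact F.mk_symbol_eq (a := c • a)
      (b := ⟨(c • (1 : R)) * a, F.mul_mem (F.smul_one_mem c) a.2⟩) (zero_add i).symm (by simp)

/-- The associated graded algebra `⨁ n, F n / F (n - 1)`. -/
abbrev Gr : Type v := DirectSum ℕ F.Piece

end AlgFiltration

/-- A (not necessarily commutative) ring is Noetherian if it is left and right Noetherian. -/
def IsLeftRightNoetherian (A : Type v) [Ring A] : Prop :=
  IsNoetherianRing A ∧ IsNoetherianRing Aᵐᵒᵖ

/-- A (not necessarily commutative) `K`-algebra `A` is finitely presented if it is the quotient
of a free associative algebra on finitely many generators by a two-sided ideal that is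
generated, as a two-sided ideal, by finitely many elements. -/
def IsFinitelyPresentedAlgebra (K : Type u) (A : Type v) [Field K] [Ring A] [Algebra K A] :
    Prop :=
  ∃ (n : ℕ) (π : FreeAlgebra K (Fin n) →ₐ[K] A), Function.Surjective π ∧
    ∃ s : Set (FreeAlgebra K (Fin n)), s.Finite ∧
      TwoSidedIdeal.ker π = TwoSidedIdeal.span s

/-! Since `F.Gr` is left Noetherian, its elements of positive degree are generated, as a left ideal,
by the symbols of finitely many `x i` of degrees `d i`, and the syzygies of these symbols by
finitely many `ρ k` of degrees `e k` (`exists_generators`, `exists_relations`). Choose `D` above all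
these degrees. Let `B` be the free algebra on a basis of `F D`, modulo the multiplication table of
`R` in total degree at most `D` and the identification of `1`. As the filtered pieces are
finite-dimensional, finitely many relations suffice (`exists_finite_multiplicativity`).

It remains to see that `B → R` is bijective. Filter `B` by layers, spanned by products of images of
the pieces up to `D`. Layers map onto the filtration of `R` because the `x i` generate
(`exists_mem_layer`). Injectivity is by induction on the layer (`eq_zero_of_mem_layer`): the leading
part of a kernel element is a syzygy, hence a combination of the `ρ k`; these have degree at most
`D`, so they already hold in `B`, and the element drops to a lower layer. -/

namespace AlgFiltration

variable {K : Type u} {R : Type v} [Field K] [Ring R] [Algebra K R] (F : AlgFiltration K R)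

/-! ### Homogeneous components of the associated graded algebra and their representatives in `R`. -/

/-- The filtration extended by `0` to negative indices. -/
def extend (n : ℤ) : Submodule K R := if 0 ≤ n then F.filt n.toNat else ⊥

theorem extend_natCast (n : ℕ) : F.extend n = F.filt n := by simp [extend]

theorem extend_of_neg {n : ℤ} (h : n < 0) : F.extend n = ⊥ := if_neg h.not_ge

theorem prev_eq_extend (n : ℕ) : F.prev n = F.extend (n - 1) := by
  cases n with
  | zero => exact (F.extend_of_neg (by norm_num)).symm
  | succ n =>
    rw [Nat.cast_succ, add_sub_cancel_right, extend_natCast]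
    rfl

theorem extend_mono : Monotone F.extend := by
  intro m n h
  rcases lt_or_ge m 0 with hm | hm
  · rw [F.extend_of_neg hm]
    exact bot_le
  · rw [extend, extend, if_pos hm, if_pos (hm.trans h)]
    exact F.mono (by omega)

theorem mul_mem_extend {i j : ℤ} {a b : R} (ha : a ∈ F.extend i) (hb : b ∈ F.extend j) :
    a * b ∈ F.extend (i + j) := by
  rcases lt_or_ge i 0 with hi | hi
  · rw [F.extend_of_neg hi, Submodule.mem_bot] at ha
    simp [ha]
  rcases lt_or_ge j 0 with hj | hj
  · rw [F.extend_of_neg hj, Submodule.mem_bot] at hb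
    simp [hb]
  lift i to ℕ using hi
  lift j to ℕ using hj
  rw [extend_natCast] at ha hb
  rw [← Nat.cast_add, extend_natCast]
  exact F.mul_mem ha hb

theorem mul_mem_extend_of_eq {i j n : ℤ} {a b : R} (ha : a ∈ F.extend i) (hb : b ∈ F.extend j)
    (h : i + j = n) : a * b ∈ F.extend n :=
  h ▸ F.mul_mem_extend ha hb

theorem one_mem_extend : (1 : R) ∈ F.extend 0 := by
  rw [← Nat.cast_zero, extend_natCast]
  exact F.one_mem

open Classical in
/-- The homogeneous element of degree `n` of the associated graded algebra given by an element
of the `n`-th filtered piece. -/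
noncomputable def gradedSymbol (n : ℤ) (a : R) : F.Gr :=
  if h : a ∈ F.filt n.toNat ∧ 0 ≤ n then DirectSum.of F.Piece n.toNat (F.symbol _ ⟨a, h.1⟩) else 0

theorem gradedSymbol_natCast {n : ℕ} {a : R} (h : a ∈ F.filt n) :
    F.gradedSymbol n a = DirectSum.of F.Piece n (F.symbol n ⟨a, h⟩) := by
  simp [gradedSymbol, h]

theorem gradedSymbol_of_neg {n : ℤ} (h : n < 0) (a : R) : F.gradedSymbol n a = 0 :=
  dif_neg fun h' => h.not_ge h'.2

/-- `r` represents the component of degree `n` of the element `z` of the associated graded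
algebra. -/
def Represents (z : F.Gr) (n : ℤ) (r : R) : Prop :=
  r ∈ F.extend n ∧ ∀ m : ℕ, (m : ℤ) = n → ∃ h : r ∈ F.filt m, z m = F.symbol m ⟨r, h⟩

variable {F}

theorem Represents.add {z w : F.Gr} {n : ℤ} {r s : R} (hr : F.Represents z n r)
    (hs : F.Represents w n s) : F.Represents (z + w) n (r + s) := by
  refine ⟨add_mem hr.1 hs.1, fun m hm => ?_⟩
  obtain ⟨h, e⟩ := hr.2 m hm
  obtain ⟨h', e'⟩ := hs.2 m hm
  exact ⟨add_mem h h', by rw [DirectSum.add_apply, e, e', ← map_add]; rfl⟩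

theorem Represents.sub {z w : F.Gr} {n : ℤ} {r s : R} (hr : F.Represents z n r)
    (hs : F.Represents w n s) : F.Represents (z - w) n (r - s) := by
  refine ⟨sub_mem hr.1 hs.1, fun m hm => ?_⟩
  obtain ⟨h, e⟩ := hr.2 m hm
  obtain ⟨h', e'⟩ := hs.2 m hm
  exact ⟨sub_mem h h', by rw [DirectSum.sub_apply, e, e', ← map_sub]; rfl⟩

variable (F) in
theorem represents_zero (n : ℤ) : F.Represents 0 n 0 :=
  ⟨zero_mem _, fun m _ => ⟨zero_mem _, (map_zero (F.symbol m)).symm⟩⟩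

theorem Represents.sum {ι : Type*} (s : Finset ι) {z : ι → F.Gr} {n : ℤ} {r : ι → R}
    (h : ∀ i, F.Represents (z i) n (r i)) :
    F.Represents (∑ i ∈ s, z i) n (∑ i ∈ s, r i) := by
  classical
  induction s using Finset.induction_on with
  | empty => simpa using F.represents_zero n
  | insert i s hi ih =>
    rw [Finset.sum_insert hi, Finset.sum_insert hi]
    exact (h i).add ih

theorem represents_of (n : ℕ) (a : F.filt n) :
    F.Represents (DirectSum.of F.Piece n (F.symbol n a)) n a := by
  refine ⟨by rw [extend_natCast]; exact a.2, fun m hm => ?_⟩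
  obtain rfl : m = n := by exact_mod_cast hm
  exact ⟨a.2, DirectSum.of_eq_same _ _⟩

theorem represents_of_ne {n : ℕ} (y : F.Piece n) {m : ℤ} (h : m ≠ n) :
    F.Represents (DirectSum.of F.Piece n y) m 0 := by
  refine ⟨zero_mem _, fun k hk => ⟨zero_mem _, ?_⟩⟩
  rw [DirectSum.of_eq_of_ne _ _ _ (by omega)]
  exact (map_zero (F.symbol k)).symm

theorem represents_gradedSymbol {n : ℤ} {a : R} (h : a ∈ F.extend n) :
    F.Represents (F.gradedSymbol n a) n a := by
  rcases lt_or_ge n 0 with hn | hn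
  · rw [F.extend_of_neg hn, Submodule.mem_bot] at h
    rw [F.gradedSymbol_of_neg hn, h]
    exact F.represents_zero n
  · lift n to ℕ using hn
    rw [extend_natCast] at h
    rw [F.gradedSymbol_natCast h]
    exact represents_of n ⟨a, h⟩

theorem Represents.mem_of_zero {n : ℤ} {r : R} (h : F.Represents 0 n r) :
    r ∈ F.extend (n - 1) := by
  rcases lt_or_ge n 0 with hn | hn
  · have := h.1
    rw [F.extend_of_neg hn, Submodule.mem_bot] at this
    rw [this]
    exact zero_mem _
  · lift n to ℕ using hn
    obtain ⟨h', e⟩ := h.2 n rfl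
    rw [← prev_eq_extend]
    exact (F.symbol_eq_zero_iff ⟨r, h'⟩).1 e.symm

theorem of_symbol_mul_gradedSymbol (n : ℕ) (a : F.filt n) {q : ℤ} {b : R} (hb : b ∈ F.extend q) :
    DirectSum.of F.Piece n (F.symbol n a) * F.gradedSymbol q b = F.gradedSymbol (n + q) (a * b) := by
  rcases lt_or_ge q 0 with hq | hq
  · rw [F.extend_of_neg hq, Submodule.mem_bot] at hb
    rw [F.gradedSymbol_of_neg hq, mul_zero, hb, mul_zero]
    unfold gradedSymbol
    split_ifs with h
    · exact ((congrArg _ (map_zero (F.symbol _))).trans (map_zero _)).symm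
    · rfl
  · lift q to ℕ using hq
    rw [extend_natCast] at hb
    rw [F.gradedSymbol_natCast hb, ← Nat.cast_add, F.gradedSymbol_natCast (F.mul_mem a.2 hb),
      DirectSum.of_mul_of]
    rfl

/-- Only the degree `p` component of `z` contributes in degree `p + q`, so any representative `c` of
it works. As `c` depends on neither `q` nor `b`, one coefficient serves all coordinates of a vector.
-/
theorem exists_represents_mul (z : F.Gr) (p : ℤ) :
    ∃ c ∈ F.extend p, ∀ (q : ℤ) (b : R), b ∈ F.extend q →
      F.Represents (z * F.gradedSymbol q b) (p + q) (c * b) := by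
  induction z using DirectSum.induction_on with
  | zero =>
    refine ⟨0, zero_mem _, fun q b _ => ?_⟩
    rw [zero_mul, zero_mul]
    exact F.represents_zero _
  | of n y =>
    obtain ⟨a, rfl⟩ := F.symbol_surjective n y
    by_cases hp : p = n
    · subst hp
      have ha : (a : R) ∈ F.extend n := by
        rw [extend_natCast]
        exact a.2
      refine ⟨a, ha, fun q b hb => ?_⟩
      rw [of_symbol_mul_gradedSymbol n a hb]
      exact represents_gradedSymbol (F.mul_mem_extend ha hb)
    · refine ⟨0, zero_mem _, fun q b hb => ?_⟩
      rw [of_symbol_mul_gradedSymbol n a hb, zero_mul]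
      unfold gradedSymbol
      split_ifs with h
      · exact represents_of_ne _ (by omega)
      · exact F.represents_zero _
  | add z w hz hw =>
    obtain ⟨c, hc, h⟩ := hz
    obtain ⟨c', hc', h'⟩ := hw
    refine ⟨c + c', add_mem hc hc', fun q b hb => ?_⟩
    rw [add_mul, add_mul]
    exact (h q b hb).add (h' q b hb)

/-- If the associated graded algebra is left Noetherian, then modulo lower order terms any set
of homogeneous vectors is generated by finitely many of its members. -/
theorem exists_finset_generating [IsNoetherianRing F.Gr] {ι : Type*} [Finite ι] (d : ι → ℤ)
    (H : Set (ℤ × (ι → R))) (hH : ∀ h ∈ H, ∀ i, h.2 i ∈ F.extend (h.1 - d i)) :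
    ∃ T : Finset (ℤ × (ι → R)), ↑T ⊆ H ∧ ∀ h ∈ H, ∃ c : T → R,
      (∀ t, c t ∈ F.extend (h.1 - t.1.1)) ∧
        ∀ i, h.2 i - ∑ t, c t * t.1.2 i ∈ F.extend (h.1 - d i - 1) := by
  classical
  -- The symbol vectors span a submodule of the Noetherian module `ι → F.Gr`, so finitely many of
  -- them suffice.
  let Φ : ℤ × (ι → R) → ι → F.Gr := fun h i => F.gradedSymbol (h.1 - d i) (h.2 i)
  obtain ⟨s, hs, hspan⟩ := (Submodule.fg_span_iff_fg_span_finset_subset (R := F.Gr) (Φ '' H)).1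
    (IsNoetherian.noetherian _)
  obtain ⟨T, hT, rfl⟩ := Finset.subset_set_image_iff.1 hs
  refine ⟨T, hT, fun h hh => ?_⟩
  have hmem : Φ h ∈ Submodule.span F.Gr (Φ '' (T : Set (ℤ × (ι → R)))) := by
    rw [← Finset.coe_image, ← hspan]
    exact Submodule.subset_span ⟨h, hh, rfl⟩
  obtain ⟨γ, hγ⟩ := (Submodule.mem_span_image_finset_iff_exists_fun F.Gr).1 hmem
  choose c hc hrep using fun t : T => exists_represents_mul (γ t) (h.1 - t.1.1)
  refine ⟨c, hc, fun i => ?_⟩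
  have h1 : F.Represents (Φ h i) (h.1 - d i) (h.2 i) := represents_gradedSymbol (hH h hh i)
  have h2 : F.Represents (∑ t, γ t * Φ t.1 i) (h.1 - d i) (∑ t, c t * t.1.2 i) :=
    Represents.sum _ fun t => by
      have := hrep t _ _ (hH t.1 (hT t.2) i)
      rwa [sub_add_sub_cancel] at this
  have h3 : Φ h i - ∑ t, γ t * Φ t.1 i = 0 := by
    rw [← hγ, Finset.sum_apply]
    exact sub_self _
  exact (h3 ▸ h1.sub h2).mem_of_zero

end AlgFiltration
-- Generators and syzygies of the associated graded algebra.
namespace AlgFiltration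

variable {K : Type u} {R : Type v} [Field K] [Ring R] [Algebra K R] {F : AlgFiltration K R}

variable (F) in
/-- If the associated graded algebra is left Noetherian, its augmentation ideal is generated by
the symbols of finitely many elements. -/
theorem exists_generators [IsNoetherianRing F.Gr] :
    ∃ (ι : Type v) (_ : Fintype ι) (d : ι → ℤ) (x : ι → R), (∀ i, 1 ≤ d i) ∧
      (∀ i, x i ∈ F.extend (d i)) ∧ ∀ n : ℤ, 1 ≤ n → ∀ a ∈ F.extend n,
        ∃ c : ι → R, (∀ i, c i ∈ F.extend (n - d i)) ∧ a - ∑ i, c i * x i ∈ F.extend (n - 1) := by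
  obtain ⟨T, hT, h⟩ := exists_finset_generating (F := F) (fun _ : Unit => (0 : ℤ))
    {h | 1 ≤ h.1 ∧ h.2 () ∈ F.extend h.1} (fun h hh _ => by simpa using hh.2)
  refine ⟨T, inferInstance, fun t => t.1.1, fun t => t.1.2 (), fun t => (hT t.2).1,
    fun t => (hT t.2).2, fun n hn a ha => ?_⟩
  obtain ⟨c, hc, hc'⟩ := h (n, fun _ => a) ⟨hn, ha⟩
  exact ⟨c, hc, by simpa using hc' ()⟩

/-- If the associated graded algebra is left Noetherian, the left module of relations between
finitely many homogeneous elements is generated by finitely many homogeneous relations. -/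
theorem exists_relations [IsNoetherianRing F.Gr] {ι : Type v} [Fintype ι] (d : ι → ℤ) (x : ι → R) :
    ∃ (κ : Type v) (_ : Fintype κ) (e : κ → ℤ) (ρ : κ → ι → R),
      (∀ k i, ρ k i ∈ F.extend (e k - d i)) ∧ (∀ k, ∑ i, ρ k i * x i ∈ F.extend (e k - 1)) ∧
      ∀ (n : ℤ) (a : ι → R), (∀ i, a i ∈ F.extend (n - d i)) →
        ∑ i, a i * x i ∈ F.extend (n - 1) →
        ∃ c : κ → R, (∀ k, c k ∈ F.extend (n - e k)) ∧
          ∀ i, a i - ∑ k, c k * ρ k i ∈ F.extend (n - d i - 1) := by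
  obtain ⟨T, hT, h⟩ := exists_finset_generating (F := F) d
    {h | (∀ i, h.2 i ∈ F.extend (h.1 - d i)) ∧ ∑ i, h.2 i * x i ∈ F.extend (h.1 - 1)}
    (fun h hh => hh.1)
  exact ⟨T, inferInstance, fun t => t.1.1, fun t => t.1.2, fun t => (hT t.2).1,
    fun t => (hT t.2).2, fun n a ha ha' => h (n, a) ⟨ha, ha'⟩⟩

/-! ### Truncated sections and the filtration by layers. -/

/-- A linear map from `R` to a `K`-algebra over `R` that is a section in degrees at most `D` and
is multiplicative as far as degrees at most `D` are concerned. -/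
structure TruncatedSection (F : AlgFiltration K R) {B : Type*} [Ring B] [Algebra K B]
    (π : B →ₐ[K] R) (D : ℕ) where
  /-- The underlying linear map. -/
  toLin : R →ₗ[K] B
  apply_toLin : ∀ v ∈ F.extend D, π (toLin v) = v
  toLin_one : toLin 1 = 1
  toLin_mul : ∀ {i j : ℤ} {a b : R}, a ∈ F.extend i → b ∈ F.extend j → i + j ≤ D →
    toLin a * toLin b = toLin (a * b)

namespace TruncatedSection

variable {B : Type*} [Ring B] [Algebra K B] {π : B →ₐ[K] R} {D : ℕ} (s : F.TruncatedSection π D)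

/-- The image of the `n`-th filtered piece. -/
def image (n : ℤ) : Submodule K B := (F.extend n).map s.toLin

/-- The filtration generated by the images of the filtered pieces of degree at most `D`. -/
def layer (n : ℤ) : Submodule K B :=
  -- The last factor has degree `j + 1`, running from `1` to `D`, so the recursion descends.
  if n ≤ D then s.image n else ⨆ j : Fin D, layer (n - 1 - (j : ℤ)) * s.image (j + 1)
termination_by n.toNat
decreasing_by omega

theorem toLin_mem_image {n : ℤ} {v : R} (h : v ∈ F.extend n) : s.toLin v ∈ s.image n :=
  Submodule.mem_map_of_mem h

theorem image_mul_image {i j : ℤ} (h : i + j ≤ D) : s.image i * s.image j ≤ s.image (i + j) := by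
  rw [Submodule.mul_le]
  rintro _ ⟨a, ha, rfl⟩ _ ⟨b, hb, rfl⟩
  rw [s.toLin_mul ha hb h]
  exact s.toLin_mem_image (F.mul_mem_extend ha hb)

theorem layer_of_le {n : ℤ} (h : n ≤ D) : s.layer n = s.image n := by
  rw [layer, if_pos h]

theorem mul_image_le_of_lt {n j : ℤ} (h : D < n) (h1 : 1 ≤ j) (hj : j ≤ D) :
    s.layer (n - j) * s.image j ≤ s.layer n := by
  rw [layer.eq_1 s n, if_neg h.not_ge]
  refine le_iSup_of_le ⟨(j - 1).toNat, by omega⟩ (le_of_eq ?_)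
  congr 2 <;> simp only <;> omega

theorem layer_le_of_lt {n : ℤ} (h : D < n) {P : Submodule K B}
    (hP : ∀ j : ℤ, 1 ≤ j → j ≤ D → s.layer (n - j) * s.image j ≤ P) : s.layer n ≤ P := by
  rw [layer, if_neg h.not_ge]
  refine iSup_le fun j => ?_
  have := hP (j + 1) (by omega) (by omega)
  rwa [← sub_sub, sub_right_comm] at this

theorem toLin_mem_layer {n : ℤ} (hn : n ≤ D) {v : R} (h : v ∈ F.extend n) :
    s.toLin v ∈ s.layer n := by
  rw [s.layer_of_le hn]
  exact s.toLin_mem_image h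

theorem mul_toLin_mem_layer {n j : ℤ} (hj : j ≤ D) {b : B} (hb : b ∈ s.layer n) {v : R}
    (hv : v ∈ F.extend j) : b * s.toLin v ∈ s.layer (n + j) := by
  rcases lt_or_ge j 0 with hj0 | hj0
  · rw [F.extend_of_neg hj0, Submodule.mem_bot] at hv
    rw [hv, map_zero, mul_zero]
    exact zero_mem _
  rcases le_or_gt (n + j) D with h | h
  · rw [s.layer_of_le (by omega)] at hb
    rw [s.layer_of_le h]
    exact s.image_mul_image h (Submodule.mul_mem_mul hb (s.toLin_mem_image hv))
  -- A factor of degree `0` is not covered by the recursion; it is absorbed into the last factor.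
  rcases hj0.eq_or_lt with rfl | hj0
  · rw [add_zero] at h ⊢
    suffices s.layer n ≤ (s.layer n).comap (LinearMap.mulRight K (s.toLin v)) from this hb
    refine s.layer_le_of_lt h fun j h1 hjD => Submodule.mul_le.2 fun c hc w hw => ?_
    have hwv : w * s.toLin v ∈ s.image j := by
      have := s.image_mul_image (i := j) (j := 0) (by omega)
        (Submodule.mul_mem_mul hw (s.toLin_mem_image hv))
      rwa [add_zero] at this
    rw [Submodule.mem_comap, LinearMap.mulRight_apply, mul_assoc]
    exact s.mul_image_le_of_lt h h1 hjD (Submodule.mul_mem_mul hc hwv)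
  · have hb' : b ∈ s.layer (n + j - j) := by rwa [add_sub_cancel_right]
    exact s.mul_image_le_of_lt h hj0 hj (Submodule.mul_mem_mul hb' (s.toLin_mem_image hv))

theorem mul_toLin_mem_layer_of_eq {n j m : ℤ} (hj : j ≤ D) {b : B} (hb : b ∈ s.layer n) {v : R}
    (hv : v ∈ F.extend j) (h : n + j = m) : b * s.toLin v ∈ s.layer m :=
  h ▸ s.mul_toLin_mem_layer hj hb hv

theorem mul_mem_layer {n m : ℤ} {b c : B} (hb : b ∈ s.layer n) (hc : c ∈ s.layer m) :
    b * c ∈ s.layer (n + m) := by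
  rcases le_or_gt m D with h | h
  · rw [s.layer_of_le h] at hc
    obtain ⟨v, hv, rfl⟩ := hc
    exact s.mul_toLin_mem_layer h hb hv
  · suffices s.layer m ≤ (s.layer (n + m)).comap (LinearMap.mulLeft K b) from this hc
    refine s.layer_le_of_lt h fun j h1 hjD => Submodule.mul_le.2 fun c hc w hw => ?_
    obtain ⟨v, hv, rfl⟩ := hw
    rw [Submodule.mem_comap, LinearMap.mulLeft_apply, ← mul_assoc]
    exact s.mul_toLin_mem_layer_of_eq hjD (mul_mem_layer hb hc) hv (by omega)
termination_by m.toNat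
decreasing_by omega

/-- Multiply by `s.toLin 1 = 1`, with `1` regarded as an element of degree `1`; this is where `1 ≤
D` enters. -/
theorem layer_mono (hD : 1 ≤ D) : Monotone s.layer :=
  monotone_int_of_le_succ fun n b hb => by
    have := s.mul_toLin_mem_layer (j := 1) (by omega) hb
      (F.extend_mono zero_le_one F.one_mem_extend)
    rwa [s.toLin_one, mul_one] at this

theorem map_mem_extend {n : ℤ} {b : B} (hb : b ∈ s.layer n) : π b ∈ F.extend n := by
  rcases le_or_gt n D with h | h
  · rw [s.layer_of_le h] at hb
    obtain ⟨v, hv, rfl⟩ := hb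
    rw [s.apply_toLin v (F.extend_mono h hv)]
    exact hv
  · suffices s.layer n ≤ (F.extend n).comap π.toLinearMap from this hb
    refine s.layer_le_of_lt h fun j h1 hjD => Submodule.mul_le.2 fun c hc w hw => ?_
    obtain ⟨v, hv, rfl⟩ := hw
    rw [Submodule.mem_comap, AlgHom.toLinearMap_apply, map_mul,
      s.apply_toLin v (F.extend_mono hjD hv)]
    exact F.mul_mem_extend_of_eq (map_mem_extend hc) hv (by omega)
termination_by n.toNat
decreasing_by omega

/-! ### Comparison of the layers with the filtration of `R`. -/

section Generators

variable {ι : Type*} [Fintype ι] {d : ι → ℤ} {x : ι → R}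

/-- Above degree `D`, expand `a` in the generators and lift the coefficients and the remainder, all
of lower degree, by induction. -/
theorem exists_mem_layer (hD : 1 ≤ D) (hd : ∀ i, 1 ≤ d i) (hdD : ∀ i, d i ≤ D)
    (hx : ∀ i, x i ∈ F.extend (d i))
    (hgen : ∀ n : ℤ, 1 ≤ n → ∀ a ∈ F.extend n, ∃ c : ι → R, (∀ i, c i ∈ F.extend (n - d i)) ∧
      a - ∑ i, c i * x i ∈ F.extend (n - 1))
    {n : ℤ} {a : R} (ha : a ∈ F.extend n) : ∃ b ∈ s.layer n, π b = a := by
  rcases le_or_gt n D with h | h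
  · exact ⟨s.toLin a, s.toLin_mem_layer h ha, s.apply_toLin a (F.extend_mono h ha)⟩
  · obtain ⟨c, hc, hc'⟩ := hgen n (by omega) a ha
    have hlift : ∀ i, ∃ b ∈ s.layer (n - d i), π b = c i := fun i => by
      have := hd i
      exact exists_mem_layer hD hd hdD hx hgen (hc i)
    choose b hb hbc using hlift
    obtain ⟨b', hb', hbc'⟩ := exists_mem_layer hD hd hdD hx hgen hc'
    refine ⟨∑ i, b i * s.toLin (x i) + b', add_mem (sum_mem fun i _ => ?_) ?_, ?_⟩
    · exact s.mul_toLin_mem_layer_of_eq (hdD i) (hb i) (hx i) (by omega)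
    · exact s.layer_mono hD (by omega) hb'
    · rw [map_add, map_sum, hbc']
      simp only [map_mul, hbc, s.apply_toLin _ (F.extend_mono (hdD _) (hx _))]
      abel
termination_by n.toNat
decreasing_by all_goals omega

/-- The expansion in the generators is applied to the last factor of a product; that factor has
degree at most `D`, where `s.toLin` is multiplicative. -/
theorem exists_sub_sum_mem_layer (hx : ∀ i, x i ∈ F.extend (d i))
    (hgen : ∀ n : ℤ, 1 ≤ n → ∀ a ∈ F.extend n, ∃ c : ι → R, (∀ i, c i ∈ F.extend (n - d i)) ∧
      a - ∑ i, c i * x i ∈ F.extend (n - 1)) (hd : ∀ i, 1 ≤ d i)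
    {n : ℤ} (h : D < n) {b : B} (hb : b ∈ s.layer n) :
    ∃ c : ι → B, (∀ i, c i ∈ s.layer (n - d i)) ∧
      b - ∑ i, c i * s.toLin (x i) ∈ s.layer (n - 1) := by
  let P : Submodule K B :=
    { carrier := {b | ∃ c : ι → B, (∀ i, c i ∈ s.layer (n - d i)) ∧
        b - ∑ i, c i * s.toLin (x i) ∈ s.layer (n - 1)}
      zero_mem' := ⟨0, fun i => zero_mem _, by simp⟩
      add_mem' := by
        rintro b b' ⟨c, hc, hbc⟩ ⟨c', hc', hbc'⟩
        refine ⟨c + c', fun i => add_mem (hc i) (hc' i), ?_⟩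
        have := add_mem hbc hbc'
        simpa only [Pi.add_apply, add_mul, Finset.sum_add_distrib, add_sub_add_comm] using this
      smul_mem' := by
        rintro r b ⟨c, hc, hbc⟩
        refine ⟨r • c, fun i => Submodule.smul_mem _ r (hc i), ?_⟩
        have := Submodule.smul_mem _ r hbc
        simpa only [Pi.smul_apply, smul_mul_assoc, ← Finset.smul_sum, ← smul_sub] using this }
  suffices s.layer n ≤ P from this hb
  refine s.layer_le_of_lt h fun j h1 hjD => Submodule.mul_le.2 fun b hb w hw => ?_
  obtain ⟨v, hv, rfl⟩ := hw
  obtain ⟨c, hc, hc'⟩ := hgen j h1 v hv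
  refine ⟨fun i => b * s.toLin (c i), fun i => ?_, ?_⟩
  · have := hd i
    exact s.mul_toLin_mem_layer_of_eq (by omega) hb (hc i) (by omega)
  · have : b * s.toLin v - ∑ i, b * s.toLin (c i) * s.toLin (x i) =
        b * s.toLin (v - ∑ i, c i * x i) := by
      rw [map_sub, map_sum, mul_sub, Finset.mul_sum]
      congr 1
      refine Finset.sum_congr rfl fun i _ => ?_
      rw [mul_assoc, s.toLin_mul (hc i) (hx i) (by omega)]
    rw [this]
    exact s.mul_toLin_mem_layer_of_eq (by omega) hb hc' (by omega)

variable {κ : Type*} [Fintype κ] {e : κ → ℤ} {ρ : κ → ι → R}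

/-- A truncated section reaching up to the degrees of the generators and relations of the
associated graded algebra forces the algebra map to be injective on the generated layers. -/
theorem eq_zero_of_mem_layer (hD : 1 ≤ D) (hd : ∀ i, 1 ≤ d i) (hdD : ∀ i, d i ≤ D)
    (hx : ∀ i, x i ∈ F.extend (d i))
    (hgen : ∀ n : ℤ, 1 ≤ n → ∀ a ∈ F.extend n, ∃ c : ι → R, (∀ i, c i ∈ F.extend (n - d i)) ∧
      a - ∑ i, c i * x i ∈ F.extend (n - 1))
    (heD : ∀ k, e k ≤ D) (hρ : ∀ k i, ρ k i ∈ F.extend (e k - d i))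
    (hρx : ∀ k, ∑ i, ρ k i * x i ∈ F.extend (e k - 1))
    (hrel : ∀ (n : ℤ) (a : ι → R), (∀ i, a i ∈ F.extend (n - d i)) →
      ∑ i, a i * x i ∈ F.extend (n - 1) →
      ∃ c : κ → R, (∀ k, c k ∈ F.extend (n - e k)) ∧
        ∀ i, a i - ∑ k, c k * ρ k i ∈ F.extend (n - d i - 1))
    {n : ℤ} {b : B} (hb : b ∈ s.layer n) (hπ : π b = 0) : b = 0 := by
  rcases le_or_gt n D with h | h
  · rw [s.layer_of_le h] at hb
    obtain ⟨v, hv, rfl⟩ := hb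
    rw [s.apply_toLin v (F.extend_mono h hv)] at hπ
    rw [hπ, map_zero]
  obtain ⟨c, hc, hbc⟩ := s.exists_sub_sum_mem_layer hx hgen hd h hb
  have hsum : ∑ i, π (c i) * x i ∈ F.extend (n - 1) := by
    have := neg_mem (s.map_mem_extend hbc)
    simpa only [map_sub, map_sum, map_mul, hπ, zero_sub, neg_neg,
      s.apply_toLin _ (F.extend_mono (hdD _) (hx _))] using this
  -- As `π b = 0`, the leading coefficients form a syzygy, a combination of the `ρ k` up to lower
  -- order.
  obtain ⟨γ, hγ, hγc⟩ := hrel n (fun i => π (c i)) (fun i => s.map_mem_extend (hc i)) hsum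
  choose g hg hgγ using fun k => s.exists_mem_layer hD hd hdD hx hgen (hγ k)
  have hgρ : ∀ k i, g k * s.toLin (ρ k i) ∈ s.layer (n - d i) := fun k i =>
    s.mul_toLin_mem_layer_of_eq (by have := hd i; have := heD k; omega) (hg k) (hρ k i) (by omega)
  have hρD : ∀ k i, π (s.toLin (ρ k i)) = ρ k i := fun k i =>
    s.apply_toLin _ (F.extend_mono (by have := hd i; have := heD k; omega) (hρ k i))
  -- The image in `R` has lower order, hence a lift `b'` in the lower layer; by induction the
  -- element equals `b'`.
  have hlow : ∀ i, c i - ∑ k, g k * s.toLin (ρ k i) ∈ s.layer (n - d i - 1) := fun i => by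
    obtain ⟨b', hb', hbπ⟩ := s.exists_mem_layer hD hd hdD hx hgen (hγc i)
    have hmem : c i - ∑ k, g k * s.toLin (ρ k i) - b' ∈ s.layer (n - d i) :=
      sub_mem (sub_mem (hc i) (sum_mem fun k _ => hgρ k i)) (s.layer_mono hD (by omega) hb')
    have hi := hd i
    have := eq_zero_of_mem_layer hD hd hdD hx hgen heD hρ hρx hrel hmem (by
      simp only [map_sub, map_sum, map_mul, hbπ, hgγ, hρD, sub_self])
    rwa [sub_eq_zero.1 this]
  -- Because `e k ≤ D`, the relation `ρ k` can be evaluated inside `s.toLin`, where it has degree at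
  -- most `e k - 1`.
  have hrelation : ∀ k, ∑ i, g k * s.toLin (ρ k i) * s.toLin (x i) ∈ s.layer (n - 1) := fun k => by
    have : ∑ i, g k * s.toLin (ρ k i) * s.toLin (x i) = g k * s.toLin (∑ i, ρ k i * x i) := by
      rw [map_sum, Finset.mul_sum]
      refine Finset.sum_congr rfl fun i _ => ?_
      rw [mul_assoc, s.toLin_mul (hρ k i) (hx i) (by have := heD k; omega)]
    rw [this]
    exact s.mul_toLin_mem_layer_of_eq (by have := heD k; omega) (hg k) (hρx k) (by omega)
  have hsplit : b = (b - ∑ i, c i * s.toLin (x i)) +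
      (∑ i, (c i - ∑ k, g k * s.toLin (ρ k i)) * s.toLin (x i) +
        ∑ k, ∑ i, g k * s.toLin (ρ k i) * s.toLin (x i)) := by
    rw [Finset.sum_comm]
    simp only [sub_mul, Finset.sum_sub_distrib, Finset.sum_mul]
    abel
  have hb' : b ∈ s.layer (n - 1) := by
    rw [hsplit]
    refine add_mem hbc (add_mem (sum_mem fun i _ => ?_) (sum_mem fun k _ => hrelation k))
    exact s.mul_toLin_mem_layer_of_eq (hdD i) (hlow i) (hx i) (by omega)
  exact eq_zero_of_mem_layer hD hd hdD hx hgen heD hρ hρx hrel hb' hπ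
termination_by n.toNat
decreasing_by all_goals omega

end Generators

end TruncatedSection
end AlgFiltration

/-! ### The choice of `D` and the finite presentation. -/

namespace AlgFiltration

variable {K : Type u} {R : Type v} [Field K] [Ring R] [Algebra K R] {F : AlgFiltration K R}

/-- If finitely many generators and relations of the associated graded algebra live in degrees
at most `D`, then any algebra over `R` that is generated by a truncated section up to degree `D`
is isomorphic to `R`. -/
theorem exists_bijective_of_truncatedSection (F : AlgFiltration K R) [IsNoetherianRing F.Gr]
    (hexh : F.IsExhaustive) :
    ∃ D : ℕ, 1 ≤ D ∧ ∀ {B : Type u} [Ring B] [Algebra K B] (π : B →ₐ[K] R)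
      (s : F.TruncatedSection π D), (∀ b, ∃ n, b ∈ s.layer n) → Function.Bijective π := by
  obtain ⟨ι, _, d, x, hd, hx, hgen⟩ := F.exists_generators
  obtain ⟨κ, _, e, ρ, hρ, hρx, hrel⟩ := exists_relations (F := F) d x
  let D : ℕ := 1 + ∑ i, (d i).toNat + ∑ k, (e k).toNat
  have hdD : ∀ i, d i ≤ D := fun i => by
    have := Finset.single_le_sum (f := fun i => (d i).toNat) (fun _ _ => Nat.zero_le _)
      (Finset.mem_univ i)
    grind
  have heD : ∀ k, e k ≤ D := fun k => by
    have := Finset.single_le_sum (f := fun k => (e k).toNat) (fun _ _ => Nat.zero_le _)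
      (Finset.mem_univ k)
    grind
  have hD : 1 ≤ D := by grind
  refine ⟨D, hD, fun π s hlayer => ⟨?_, fun r => ?_⟩⟩
  · rw [injective_iff_map_eq_zero]
    intro b hb
    obtain ⟨n, hn⟩ := hlayer b
    exact s.eq_zero_of_mem_layer hD hd hdD hx hgen heD hρ hρx hrel hn hb
  · obtain ⟨n, hn⟩ := hexh r
    rw [← extend_natCast] at hn
    obtain ⟨b, -, hb⟩ := s.exists_mem_layer hD hd hdD hx hgen hn
    exact ⟨b, hb⟩

/-- An algebra map from a free algebra whose generators are sent to the image of a truncated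
section has values in the layers of the section. -/
theorem TruncatedSection.exists_mem_layer_of_freeAlgebra {B : Type*} [Ring B] [Algebra K B]
    {π : B →ₐ[K] R} {D : ℕ} (s : F.TruncatedSection π D) {X : Type*}
    (q : FreeAlgebra K X →ₐ[K] B) (hq : ∀ i, ∃ v ∈ F.extend D, q (FreeAlgebra.ι K i) = s.toLin v)
    (hmono : Monotone s.layer) (t : FreeAlgebra K X) : ∃ n, q t ∈ s.layer n := by
  induction t using FreeAlgebra.induction with
  | grade0 r =>
    refine ⟨0, ?_⟩
    rw [AlgHom.commutes, Algebra.algebraMap_eq_smul_one, ← s.toLin_one]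
    exact Submodule.smul_mem _ r (s.toLin_mem_layer (by omega) F.one_mem_extend)
  | grade1 i =>
    obtain ⟨v, hv, h⟩ := hq i
    exact ⟨D, h ▸ s.toLin_mem_layer le_rfl hv⟩
  | mul a b ha hb =>
    obtain ⟨m, hm⟩ := ha
    obtain ⟨n, hn⟩ := hb
    exact ⟨m + n, map_mul q a b ▸ s.mul_mem_layer hm hn⟩
  | add a b ha hb =>
    obtain ⟨m, hm⟩ := ha
    obtain ⟨n, hn⟩ := hb
    exact ⟨max m n, map_add q a b ▸
      add_mem (hmono (le_max_left m n) hm) (hmono (le_max_right m n) hn)⟩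

/-- Multiplicativity of a linear map in bounded degrees is a finite set of conditions. -/
theorem exists_finite_multiplicativity (F : AlgFiltration K R) (hfin : F.IsFiniteDimensional)
    (D : ℕ) : ∃ S : Set (R × R), S.Finite ∧ (∀ p ∈ S, p.1 ∈ F.extend D ∧ p.2 ∈ F.extend D ∧
        p.1 * p.2 ∈ F.extend D) ∧
      ∀ {B : Type u} [Ring B] [Algebra K B] (f : R →ₗ[K] B),
        (∀ p ∈ S, f p.1 * f p.2 = f (p.1 * p.2)) →
        ∀ {i j : ℤ} {a b : R}, a ∈ F.extend i → b ∈ F.extend j → i + j ≤ D →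
          f a * f b = f (a * b) := by
  choose X hX hspan using fun n => Submodule.fg_def.1 (Module.Finite.iff_fg.1 (hfin n))
  have hXF : ∀ n, ∀ a ∈ X n, a ∈ F.filt n := fun n a ha => hspan n ▸ Submodule.subset_span ha
  -- Pairs from finite spanning sets of the pieces `i`, `j` with `i + j ≤ D`; bilinearity gives the
  -- rest.
  refine ⟨⋃ i ∈ Finset.range (D + 1), ⋃ j ∈ Finset.range (D + 1 - i), X i ×ˢ X j, ?_, ?_, ?_⟩
  · exact Set.Finite.biUnion (Finset.finite_toSet _) fun i _ =>
      Set.Finite.biUnion (Finset.finite_toSet _) fun j _ => (hX i).prod (hX j)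
  · intro p hp
    simp only [Set.mem_iUnion, Finset.mem_range, Set.mem_prod] at hp
    obtain ⟨i, hi, j, hj, h1, h2⟩ := hp
    simp only [extend_natCast]
    exact ⟨F.mono (by omega) (hXF i _ h1), F.mono (by omega) (hXF j _ h2),
      F.mono (by omega) (F.mul_mem (hXF i _ h1) (hXF j _ h2))⟩
  · intro B _ _ f hf i j a b ha hb hij
    rcases lt_or_ge i 0 with hi | hi
    · rw [F.extend_of_neg hi, Submodule.mem_bot] at ha
      simp [ha]
    rcases lt_or_ge j 0 with hj | hj
    · rw [F.extend_of_neg hj, Submodule.mem_bot] at hb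
      simp [hb]
    lift i to ℕ using hi
    lift j to ℕ using hj
    rw [extend_natCast, ← hspan] at ha hb
    induction ha, hb using Submodule.span_induction₂ with
    | mem_mem a b ha hb =>
      refine hf (a, b) ?_
      simp only [Set.mem_iUnion, Finset.mem_range, Set.mem_prod]
      exact ⟨i, by omega, j, by omega, ha, hb⟩
    | zero_left => simp
    | zero_right => simp
    | add_left a a' b _ _ _ h h' => rw [map_add, add_mul, add_mul, map_add, h, h']
    | add_right a b b' _ _ _ h h' => rw [map_add, mul_add, mul_add, map_add, h, h']
    | smul_left r a b _ _ h => rw [map_smul, smul_mul_assoc, smul_mul_assoc, map_smul, h]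
    | smul_right r a b _ _ h => rw [map_smul, mul_smul_comm, mul_smul_comm, map_smul, h]

end AlgFiltration

theorem theorem1p1 {K : Type u} {R : Type v} [Field K] [Ring R] [Algebra K R]
    (F : AlgFiltration K R) (hfin : F.IsFiniteDimensional) (hexh : F.IsExhaustive)
    (hgr : IsLeftRightNoetherian F.Gr) :
    IsFinitelyPresentedAlgebra K R := by
  have := hgr.1
  obtain ⟨D, hD, hbij⟩ := F.exists_bijective_of_truncatedSection hexh
  obtain ⟨S, hS, hSD, hSmul⟩ := F.exists_finite_multiplicativity hfin D
  have : Module.Finite K (F.extend D) := by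
    rw [AlgFiltration.extend_natCast]
    exact hfin D
  let b := Module.finBasis K (F.extend D)
  -- Basis vectors go to free generators; the values of `σ` outside `F.extend D` are arbitrary and
  -- never matter.
  obtain ⟨σ, hσ⟩ := LinearMap.exists_extend (b.constr K (FreeAlgebra.ι K))
  have hσb : ∀ i, σ (b i) = FreeAlgebra.ι K i := fun i => by
    simpa using LinearMap.congr_fun hσ (b i)
  let π := FreeAlgebra.lift K fun i => (b i : R)
  have hπσ : ∀ v ∈ F.extend D, π (σ v) = v := by
    have : π.toLinearMap ∘ₗ σ ∘ₗ (F.extend D).subtype = (F.extend D).subtype :=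
      b.ext fun i => by simp [hσb, π]
    exact fun v hv => LinearMap.congr_fun this ⟨v, hv⟩
  have hone : (1 : R) ∈ F.extend D := F.extend_mono (Int.natCast_nonneg D) F.one_mem_extend
  let rels : Set (FreeAlgebra K (Fin (Module.finrank K (F.extend D)))) :=
    insert (σ 1 - 1) ((fun p : R × R => σ p.1 * σ p.2 - σ (p.1 * p.2)) '' S)
  let I := TwoSidedIdeal.span rels
  have hI : I ≤ TwoSidedIdeal.ker π := by
    refine TwoSidedIdeal.span_le.2 ?_
    rintro _ (rfl | ⟨p, hp, rfl⟩) <;> rw [SetLike.mem_coe, TwoSidedIdeal.mem_ker]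
    · rw [map_sub, hπσ 1 hone, map_one, sub_self]
    · obtain ⟨h1, h2, h3⟩ := hSD p hp
      rw [map_sub, map_mul, hπσ _ h1, hπσ _ h2, hπσ _ h3, sub_self]
  let q := I.ringCon.mkₐ K
  have hq : ∀ t ∈ I, q t = 0 := fun t ht => (RingCon.eq _).2 ((I.mem_iff t).1 ht)
  let πI : I.ringCon.Quotient →ₐ[K] R := I.ringCon.liftₐ π fun x y h => by
    have h' := hI ((I.rel_iff x y).1 h)
    rw [TwoSidedIdeal.mem_ker, map_sub] at h'
    exact sub_eq_zero.1 h'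
  have hπI : ∀ t, πI (q t) = π t := fun t => rfl
  let s : F.TruncatedSection πI D :=
    { toLin := q.toLinearMap ∘ₗ σ
      apply_toLin := fun v hv => hπσ v hv
      toLin_one := by
        have := hq _ (TwoSidedIdeal.subset_span (Set.mem_insert _ _))
        rw [map_sub, map_one q] at this
        exact sub_eq_zero.1 this
      toLin_mul := hSmul _ fun p hp => by
        have := hq _ (TwoSidedIdeal.subset_span (Set.mem_insert_of_mem _ ⟨p, hp, rfl⟩))
        rw [map_sub, map_mul] at this
        exact sub_eq_zero.1 this }
  have hbijective : Function.Bijective πI := hbij πI s fun z => by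
    obtain ⟨t, rfl⟩ := I.ringCon.mkₐ_surjective (α := K) z
    exact s.exists_mem_layer_of_freeAlgebra q
      (fun i => ⟨b i, (b i).2, congrArg q (hσb i).symm⟩) (s.layer_mono hD) t
  refine ⟨_, π, hbijective.2.comp (I.ringCon.mkₐ_surjective (α := K)), rels,
    (hS.image _).insert _, le_antisymm (fun t ht => ?_) hI⟩
  -- Injectivity of `πI` says exactly that `rels` generates the whole kernel of `π`.
  rw [TwoSidedIdeal.mem_ker, ← hπI] at ht
  exact (I.mem_iff t).2 ((RingCon.eq _).1 (hbijective.1 (ht.trans (map_zero πI).symm)))
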